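/- Let $m\ge 4$, let $\mathcal A$ be a set of $m$ alternatives and let $\mathcal L(\mathcal A)$ be the set of linear orders (votes) on $\mathcal A$; write $a\succ_R b$ if $R\in\mathcal L(\mathcal A)$ ranks $a$ above $b$. An $n$-profile is a vector $P\in\mathcal L(\mathcal A)^n$ of votes, and a voting rule $r$ maps every profile to a single alternative. The Condorcet winner of $P$, if it exists, is the alternative $a$ such that for every $b\ne a$ strictly more votes in $P$ rank $a$ above $b$ than rank $b$ above $a$. The rule $r$ satisfies the Condorcet criterion at $P$ if either $P$ has no Condorcet winner or $r(P)$ is the Condorcet winner of $P$. For an integer $B\ge 1$, $r$ satisfies group half-way monotonicity at $P$ with group size $B$ if there is no nonempty set $S$ of at most $B$ voters such that, with $P'$ the profile obtained from $P$ by reversing the votes of exactly the voters in $S$, every voter $j\in S$ (with vote $R_j$ in $P$) has $r(P')\succ_{R_j} r(P)$. For a set $\Pi$ of probability distributions on $\mathcal L(\mathcal A)$ let $$\mathrm{Sat}_\Pi(r,n,B)=\inf_{(\pi_1,\dots,\pi_n)\in\Pi^n}\Pr\bigl(r\text{ satisfies at }P\text{ both the Condorcet criterion and group half-way monotonicity with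 group size }B\bigr),$$ where the votes of the $n$-profile $P$ are drawn independently, the $j$-th one from $\pi_j$. Suppose that $\Pi$ is strictly positive (there is $\epsilon>0$ with $\pi(R)\ge\epsilon$ for all $\pi\in\Pi$ and $R\in\mathcal L(\mathcal A)$), that $\Pi$ is closed in the probability simplex in $\mathbb R^{m!}$, and that the uniform distribution on $\mathcal L(\mathcal A)$ lies in the convex hull of $\Pi$. Then there is a constant $C>0$, depending only on $m$ and $\Pi$, such that for every voting rule $r$, every $n\ge 24$ and every integer $B$ with $1\le B\le\sqrt n$, $$\mathrm{Sat}_\Pi(r,n,B)\le 1-C\,\frac{B}{\sqrt n}.$$ -/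

import Mathlib

namespace SemiRandomVoting

/-- A vote over the `m` alternatives `Fin m`: a linear order, given by the bijection that sends
every alternative to its rank (rank `0` is the top). -/
abbrev Vote (m : ℕ) : Type := Equiv.Perm (Fin m)

/-- `R.Prefers a b`: the vote `R` ranks `a` strictly above `b`. -/
def Vote.Prefers {m : ℕ} (R : Vote m) (a b : Fin m) : Prop := R a < R b

instance {m : ℕ} (R : Vote m) (a b : Fin m) : Decidable (Vote.Prefers R a b) :=
  inferInstanceAs (Decidable (R a < R b))

/-- The reverse of a vote: the alternative of rank `k` gets rank `m - 1 - k`. -/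
def Vote.reverse {m : ℕ} (R : Vote m) : Vote m := R.trans Fin.revPerm

theorem Vote.reverse_prefers {m : ℕ} (R : Vote m) (a b : Fin m) :
    Vote.Prefers (Vote.reverse R) a b ↔ Vote.Prefers R b a := by
  simp [Vote.Prefers, Vote.reverse]

/-- An `n`-profile: one vote for each of `n` voters. -/
abbrev Profile (m n : ℕ) : Type := Fin n → Vote m

/-- A (resolute) voting rule maps every profile, of any size, to a single winner. -/
abbrev VotingRule (m : ℕ) : Type := (n : ℕ) → Profile m n → Fin m

/-- `P[a ≻ b]`: the number of votes in `P` that prefer `a` to `b`. -/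
def prefCount {m n : ℕ} (P : Profile m n) (a b : Fin m) : ℕ :=
  (Finset.univ.filter fun j => Vote.Prefers (P j) a b).card

/-- The weight of the edge `a → b` in the weighted majority graph of `P`. -/
def majorityWeight {m n : ℕ} (P : Profile m n) (a b : Fin m) : ℤ :=
  (prefCount P a b : ℤ) - (prefCount P b a : ℤ)

/-- `a` is the Condorcet winner of `P`: all its outgoing edges have positive weight. -/
def IsCondorcetWinner {m n : ℕ} (P : Profile m n) (a : Fin m) : Prop :=
  ∀ b, b ≠ a → 0 < majorityWeight P a b

/-- A per-profile axiom: satisfied or not by a rule, at a profile, with respect to a group size. -/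
abbrev PerProfileAxiom (m : ℕ) : Type :=
  VotingRule m → (n : ℕ) → Profile m n → ℕ → Prop

/-- The Condorcet criterion: if `P` has a Condorcet winner, then the rule selects it.
It does not depend on the group size. -/
def CC (m : ℕ) : PerProfileAxiom m := fun r n P _ =>
  ∀ a, IsCondorcetWinner P a → r n P = a

/-- The profile obtained from `P` when exactly the voters in `S` reverse their votes. -/
def flip {m n : ℕ} (P : Profile m n) (S : Finset (Fin n)) : Profile m n :=
  fun j => if j ∈ S then Vote.reverse (P j) else P j

/-- Group half-way monotonicity: there is no nonempty coalition of at most `B` voters who, by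
reversing their votes, obtain a winner that each of them prefers (under the original vote). -/
def HM (m : ℕ) : PerProfileAxiom m := fun r n P B =>
  ¬ ∃ S : Finset (Fin n), S.Nonempty ∧ S.card ≤ B ∧
    ∀ j ∈ S, Vote.Prefers (P j) (r n (flip P S)) (r n P)

/-- Simultaneous satisfaction of the Condorcet criterion and half-way monotonicity. -/
def CandH (m : ℕ) : PerProfileAxiom m := fun r n P B => CC m r n P B ∧ HM m r n P B

open Classical in
/-- The probability of the event `E` when the votes are drawn independently, the vote of voter `j`
from the distribution `p j`. -/
noncomputable def profilePr {m n : ℕ} (p : Fin n → Vote m → ℝ) (E : Profile m n → Prop) : ℝ :=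
  ∑ P : Profile m n, if E P then ∏ j, p j (P j) else 0

/-- The semi-random satisfaction of the axiom `X`: the infimum, over all ways to assign to each of
the `n` voters a distribution in `D`, of the probability that `X` is satisfied. -/
noncomputable def semiRandomSat {m : ℕ} (X : PerProfileAxiom m) (D : Set (Vote m → ℝ))
    (r : VotingRule m) (n B : ℕ) : ℝ :=
  ⨅ p : Fin n → D, profilePr (fun j => (p j : Vote m → ℝ)) (fun P => X r n P B)

/-- The admissible sets `D` of distributions over votes: a strictly positive, closed set of
probability vectors whose convex hull contains the uniform distribution. -/
structure Admissible {m : ℕ} (D : Set (Vote m → ℝ)) : Prop where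
  subset_simplex : D ⊆ stdSimplex ℝ (Vote m)
  strictlyPositive : ∃ ε : ℝ, 0 < ε ∧ ∀ p ∈ D, ∀ R : Vote m, ε ≤ p R
  closed : IsClosed D
  uniform_mem : (fun _ => 1 / (m.factorial : ℝ)) ∈ convexHull ℝ D

end SemiRandomVoting

/-!
The set `D` enters only through the uniform distribution. Since the probability of an event is
multilinear in the `n` distributions, the probability under uniformly distributed votes is a
weighted average of the probabilities over which the infimum is taken
(`semiRandomSat_le_profilePr_uniform`). So it suffices to show that every rule violates one of the
two criteria at a fraction of at least `C * B / √n` of all profiles.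

*Why violations exist.* By half-way monotonicity, when voters with a common vote `R` reverse their
votes, in coalitions of at most `B`, the winner can only move down in `R`. If the winner is ranked
last in `R`, it therefore stays the winner; if another alternative becomes the Condorcet winner on
the way, this is a contradiction. Consider a profile whose margins are close to a multiple of those
of 24 voters with the votes `adbc` (6), `bcad` (6), `cadb` (4), `dbac` (4), `dbca` (4), all further
alternatives being at the bottom. Nine families of reversals starting there lead to Condorcet
winners at four places, and following the winner along them is contradictory
(`false_of_monotone`, `exists_not_satisfies`). These margins leave enough room for one more voter,
or for a perturbation by a small fraction of the common multiple. With added pairs of opposite votes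
this gives a violation for every `n ≥ 24` (`exists_not_satisfies_of_le`), which is all that is needed
for the finitely many small `n`.

*Why violations are frequent.* For large `n`, a uniformly random profile has margins of the order
`√n` (`le_card_typicalProfiles`, `abs_majorityWeight_le`). Let a unit consist of about `m! * √n`
voters, divided into `q`, of the order `√n / B`, coalitions of size `B`. Starting from a typical
profile, the reversal of a bounded number of units installs the margins above up to a small error,
and then one of only `9 * (4 * q + 1)` further profiles, each obtained by the reversal of
prescribed numbers of voters of each kind, violates a criterion. Each of these maps changes the
vote counts by a fixed vector of length `O(√n)`. Averaged over all renamings of the voters, such a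
map distorts the uniform distribution by a bounded factor only, because the factorials in the
multinomial coefficients are compared at distance `O(√n)` near `n / m!`
(`factorial_le_zpow_mul`, `symmetryCount_le`, `sum_card_comp_mem_le`). Hence the fraction of
violations is at least a constant divided by the number of maps
(`card_le_of_forall_exists_comp_mem`, `card_not_satisfies_of_large`).
-/

namespace SemiRandomVoting

/-! ### Majority margins and counts of votes -/

/-- The contribution of a single vote to the margin of `x` over `y`: `1` if it ranks `x` above `y`,
`-1` if it ranks `y` above `x`, and `0` if `x = y`. -/
def voteSign {m : ℕ} (R : Vote m) (x y : Fin m) : ℤ :=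
  (if Vote.Prefers R x y then 1 else 0) - (if Vote.Prefers R y x then 1 else 0)

theorem majorityWeight_eq_sum {m n : ℕ} (P : Profile m n) (x y : Fin m) :
    majorityWeight P x y = ∑ j, voteSign (P j) x y := by
  simp [majorityWeight, prefCount, voteSign, Finset.sum_sub_distrib]

theorem voteSign_reverse {m : ℕ} (R : Vote m) (x y : Fin m) :
    voteSign (Vote.reverse R) x y = -voteSign R x y := by
  simp only [voteSign, Vote.reverse_prefers]
  ring

theorem reverse_reverse {m : ℕ} (R : Vote m) : Vote.reverse (Vote.reverse R) = R := by
  ext x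
  simp [Vote.reverse]

theorem abs_voteSign_le_one {m : ℕ} (R : Vote m) (x y : Fin m) : |voteSign R x y| ≤ 1 := by
  unfold voteSign
  split_ifs <;> simp

theorem majorityWeight_flip {m n : ℕ} (P : Profile m n) (S : Finset (Fin n)) (x y : Fin m) :
    majorityWeight (flip P S) x y = majorityWeight P x y - 2 * ∑ j ∈ S, voteSign (P j) x y := by
  rw [majorityWeight_eq_sum, majorityWeight_eq_sum, Finset.mul_sum,
    ← Finset.sum_filter_add_sum_filter_not Finset.univ (· ∈ S),
    ← Finset.sum_filter_add_sum_filter_not Finset.univ (· ∈ S) (fun j => voteSign (P j) x y)]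
  have h1 : ∑ j with j ∈ S, voteSign (flip P S j) x y = - ∑ j ∈ S, voteSign (P j) x y := by
    rw [← Finset.sum_neg_distrib]
    refine Finset.sum_congr (by simp) fun j hj => ?_
    simp [flip, hj, voteSign_reverse]
  have h2 : ∑ j with ¬ j ∈ S, voteSign (flip P S j) x y = ∑ j with ¬ j ∈ S, voteSign (P j) x y :=
    Finset.sum_congr rfl fun j hj => by simp [flip, (Finset.mem_filter.1 hj).2]
  have h3 : ∑ j with j ∈ S, voteSign (P j) x y = ∑ j ∈ S, voteSign (P j) x y :=
    Finset.sum_congr (by simp) fun j _ => rfl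
  rw [h1, h2, h3, ← Finset.mul_sum]
  ring

/-- The number of voters of the profile `P` who cast the vote `R`. -/
def voteCount {m n : ℕ} (P : Profile m n) (R : Vote m) : ℕ :=
  (Finset.univ.filter fun j => P j = R).card

theorem sum_voteCount {m n : ℕ} (P : Profile m n) : ∑ R, voteCount P R = n := by
  have := Finset.card_eq_sum_card_fiberwise (f := P) (s := Finset.univ) (t := Finset.univ)
    (fun _ _ => by simp)
  simpa [voteCount] using this.symm

theorem majorityWeight_eq_sum_voteCount {m n : ℕ} (P : Profile m n) (x y : Fin m) :
    majorityWeight P x y = ∑ R, (voteCount P R : ℤ) * voteSign R x y := by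
  rw [majorityWeight_eq_sum, ← Finset.sum_fiberwise_of_maps_to (s := Finset.univ)
    (t := Finset.univ) (g := P) (fun _ _ => by simp)]
  refine Finset.sum_congr rfl fun R _ => ?_
  rw [Finset.sum_congr rfl (g := fun _ => voteSign R x y)
    (fun j hj => by rw [(Finset.mem_filter.1 hj).2])]
  simp [voteCount]

/-! ### Flipping prescribed numbers of voters of each kind -/

/-- The position of voter `j` among the voters who cast the same vote as `j`. -/
def voterIndex {m n : ℕ} (P : Profile m n) (j : Fin n) : ℕ :=
  (Finset.univ.filter fun i => i < j ∧ P i = P j).card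

/-- The set consisting of the first `k R` voters with vote `R`, for every vote `R`. -/
def firstVoters {m n : ℕ} (P : Profile m n) (k : Vote m → ℕ) : Finset (Fin n) :=
  Finset.univ.filter fun j => voterIndex P j < k (P j)

theorem voterIndex_lt {m n : ℕ} {P : Profile m n} {i j : Fin n} (h : i < j) (hP : P i = P j) :
    voterIndex P i < voterIndex P j := by
  refine Finset.card_lt_card ⟨fun l hl => ?_, fun hs => ?_⟩
  · simp only [Finset.mem_filter, Finset.mem_univ, true_and] at hl ⊢
    exact ⟨hl.1.trans h, hl.2.trans hP⟩
  · have : i ∈ Finset.univ.filter fun l => l < i ∧ P l = P i :=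
      hs (by simp [h, hP])
    simp at this

theorem image_voterIndex {m n : ℕ} (P : Profile m n) (R : Vote m) :
    (Finset.univ.filter fun j => P j = R).image (voterIndex P) = Finset.range (voteCount P R) := by
  have inj : Set.InjOn (voterIndex P) (Finset.univ.filter fun j => P j = R : Finset (Fin n)) := by
    intro i hi j hj hij
    simp only [Finset.coe_filter, Finset.mem_univ, true_and, Set.mem_ofPred_eq] at hi hj
    rcases lt_trichotomy i j with h | h | h
    · exact absurd hij (voterIndex_lt h (hi.trans hj.symm)).ne
    · exact h
    · exact absurd hij (voterIndex_lt h (hj.trans hi.symm)).ne'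
  refine Finset.eq_of_subset_of_card_le (fun l hl => ?_) ?_
  · obtain ⟨j, hj, rfl⟩ := Finset.mem_image.1 hl
    simp only [Finset.mem_filter, Finset.mem_univ, true_and] at hj
    rw [Finset.mem_range]
    refine Finset.card_lt_card ⟨fun l hl => ?_, fun hs => ?_⟩
    · simp only [Finset.mem_filter, Finset.mem_univ, true_and] at hl ⊢
      exact hl.2.trans hj
    · have : j ∈ Finset.univ.filter fun l => l < j ∧ P l = P j := hs (by simp [hj])
      simp at this
  · rw [Finset.card_image_of_injOn inj, Finset.card_range, voteCount]

/-- Among the voters with vote `R`, exactly `b - a` have an index in `[a, b)`. -/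
theorem card_voterIndex_mem {m n : ℕ} (P : Profile m n) (R : Vote m) {a b : ℕ}
    (hb : b ≤ voteCount P R) :
    (Finset.univ.filter fun j => P j = R ∧ a ≤ voterIndex P j ∧ voterIndex P j < b).card
      = b - a := by
  have inj : Set.InjOn (voterIndex P) (Finset.univ.filter fun j => P j = R : Finset (Fin n)) := by
    rw [← Finset.card_image_iff, image_voterIndex, Finset.card_range, voteCount]
  have : ((Finset.univ.filter fun j => P j = R ∧ a ≤ voterIndex P j ∧ voterIndex P j < b).image
      (voterIndex P)) = Finset.Ico a b := by
    ext l
    simp only [Finset.mem_image, Finset.mem_filter, Finset.mem_univ, true_and, Finset.mem_Ico]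
    constructor
    · rintro ⟨j, ⟨-, h1, h2⟩, rfl⟩
      exact ⟨h1, h2⟩
    · rintro ⟨h1, h2⟩
      have hl : l ∈ Finset.range (voteCount P R) := Finset.mem_range.2 (h2.trans_le hb)
      rw [← image_voterIndex] at hl
      obtain ⟨j, hj, rfl⟩ := Finset.mem_image.1 hl
      exact ⟨j, ⟨(Finset.mem_filter.1 hj).2, h1, h2⟩, rfl⟩
  rw [← Nat.card_Ico, ← this, Finset.card_image_of_injOn]
  refine inj.mono fun j hj => ?_
  simp only [Finset.coe_filter, Finset.mem_univ, true_and, Set.mem_ofPred_eq] at hj ⊢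
  exact hj.1

theorem card_firstVoters_filter {m n : ℕ} (P : Profile m n) (k : Vote m → ℕ) (R : Vote m)
    (hk : k R ≤ voteCount P R) :
    ((firstVoters P k).filter fun j => P j = R).card = k R := by
  rw [← Nat.sub_zero (k R), ← card_voterIndex_mem P R (a := 0) hk]
  congr 1
  ext j
  simp only [firstVoters, Finset.mem_filter, Finset.mem_univ, true_and, Nat.zero_le]
  constructor
  · rintro ⟨h, rfl⟩; exact ⟨rfl, h⟩
  · rintro ⟨rfl, h⟩; exact ⟨h, rfl⟩

/-- The profile obtained from `P` when, for every vote `R`, the first `k R` voters with vote `R`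
reverse their votes. -/
def flipFirst {m n : ℕ} (P : Profile m n) (k : Vote m → ℕ) : Profile m n :=
  flip P (firstVoters P k)

theorem majorityWeight_flipFirst {m n : ℕ} (P : Profile m n) (k : Vote m → ℕ)
    (hk : ∀ R, k R ≤ voteCount P R) (x y : Fin m) :
    majorityWeight (flipFirst P k) x y
      = majorityWeight P x y - 2 * ∑ R, (k R : ℤ) * voteSign R x y := by
  rw [flipFirst, majorityWeight_flip]
  congr 2
  rw [← Finset.sum_fiberwise_of_maps_to (s := firstVoters P k)
    (t := Finset.univ) (g := P) (fun _ _ => by simp)]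
  refine Finset.sum_congr rfl fun R _ => ?_
  rw [Finset.sum_congr rfl (g := fun _ => voteSign R x y)
    (fun j hj => by rw [(Finset.mem_filter.1 hj).2])]
  simp [card_firstVoters_filter P k R (hk R)]

theorem voteCount_flipFirst {m n : ℕ} (P : Profile m n) (k : Vote m → ℕ)
    (hk : ∀ R, k R ≤ voteCount P R) (R : Vote m) :
    voteCount (flipFirst P k) R + k R = voteCount P R + k (Vote.reverse R) := by
  have h1 : voteCount (flipFirst P k) R
      = (Finset.univ.filter fun j => P j = R ∧ j ∉ firstVoters P k).card
        + ((firstVoters P k).filter fun j => P j = Vote.reverse R).card := by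
    rw [← Finset.card_union_of_disjoint, voteCount]
    · congr 1
      ext j
      by_cases hj : j ∈ firstVoters P k
      · have : Vote.reverse (P j) = R ↔ P j = Vote.reverse R :=
          ⟨fun h => by rw [← h, reverse_reverse], fun h => by rw [h, reverse_reverse]⟩
        simp only [Finset.mem_filter, Finset.mem_univ, true_and, Finset.mem_union, hj,
          not_true, and_false, false_or]
        simp [flipFirst, flip, hj, this]
      · simp only [Finset.mem_filter, Finset.mem_univ, true_and, Finset.mem_union, hj,
          not_false_eq_true, and_true, false_and, or_false]
        simp [flipFirst, flip, hj]
    · rw [Finset.disjoint_left]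
      intro j hj hj'
      exact (Finset.mem_filter.1 hj).2.2 (Finset.mem_filter.1 hj').1
  have h2 : voteCount P R = (Finset.univ.filter fun j => P j = R ∧ j ∉ firstVoters P k).card
        + ((firstVoters P k).filter fun j => P j = R).card := by
    rw [← Finset.card_union_of_disjoint, voteCount]
    · congr 1
      ext j
      by_cases hj : j ∈ firstVoters P k <;> simp [hj]
    · rw [Finset.disjoint_left]
      intro j hj hj'
      exact (Finset.mem_filter.1 hj).2.2 (Finset.mem_filter.1 hj').1
  rw [card_firstVoters_filter P k _ (hk _)] at h1 h2
  omega

/-- Raising the budget of a single vote `R` by `t` amounts to the reversal of exactly `t` voters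
who currently have the vote `R`. -/
theorem flipFirst_add_single {m n : ℕ} (P : Profile m n) (k : Vote m → ℕ) (R : Vote m) (t : ℕ)
    (hk : k R + t ≤ voteCount P R) :
    ∃ S : Finset (Fin n), S.card = t ∧ (∀ j ∈ S, flipFirst P k j = R) ∧
      flipFirst P (Function.update k R (k R + t)) = flip (flipFirst P k) S := by
  refine ⟨_, (card_voterIndex_mem P R (a := k R) hk).trans (by omega), fun j hj => ?_, ?_⟩
  · simp only [Finset.mem_filter, Finset.mem_univ, true_and] at hj
    obtain ⟨rfl, h1, h2⟩ := hj
    simp [flipFirst, flip, firstVoters, h1]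
  · funext j
    by_cases hj : P j = R
    · subst hj
      simp only [flipFirst, flip, firstVoters, Finset.mem_filter, Finset.mem_univ, true_and,
        Function.update_self]
      split_ifs <;> first | rfl | omega
    · simp [flipFirst, flip, firstVoters, hj]

/-! ### Five votes and their margins -/

/-- Five votes over four alternatives `a = 0`, `b = 1`, `c = 2`, `d = 3`, in the order
`adbc`, `bcad`, `cadb`, `dbac`, `dbca`; each maps an alternative to its rank. -/
def smallVote : Fin 5 → Vote 4 :=
  ![⟨![0, 2, 3, 1], ![0, 3, 1, 2], by decide, by decide⟩,
    ⟨![2, 0, 1, 3], ![1, 2, 0, 3], by decide, by decide⟩,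
    ⟨![1, 3, 0, 2], ![2, 0, 3, 1], by decide, by decide⟩,
    ⟨![2, 1, 3, 0], ![3, 1, 0, 2], by decide, by decide⟩,
    ⟨![3, 1, 2, 0], ![3, 1, 2, 0], by decide, by decide⟩]

/-- The five votes `smallVote` extended to `m ≥ 4` alternatives: the alternatives `4, 5, …` follow
below the first four, in this order. -/
def baseVote {m : ℕ} (hm : 4 ≤ m) (i : Fin 5) : Vote m :=
  (smallVote i).viaFintypeEmbedding (Fin.castLEEmb hm)

/-- How many voters (in units of a common size) cast each of the five votes in the profile whose
margins drive the contradiction. -/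
def template : Fin 5 → ℕ := ![6, 6, 4, 4, 4]

theorem baseVote_castLE {m : ℕ} (hm : 4 ≤ m) (i : Fin 5) (x : Fin 4) :
    baseVote hm i (Fin.castLE hm x) = Fin.castLE hm (smallVote i x) :=
  Equiv.Perm.viaFintypeEmbedding_apply_image (smallVote i) (Fin.castLEEmb hm) x

theorem baseVote_of_four_le {m : ℕ} (hm : 4 ≤ m) (i : Fin 5) {y : Fin m} (hy : 4 ≤ y.val) :
    baseVote hm i y = y := by
  refine Equiv.Perm.viaFintypeEmbedding_apply_notMem_range (smallVote i) (Fin.castLEEmb hm) ?_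
  rintro ⟨x, hx⟩
  have := congrArg Fin.val hx
  simp at this
  omega

theorem eq_castLE_or_four_le {m : ℕ} (hm : 4 ≤ m) (y : Fin m) :
    (∃ x : Fin 4, y = Fin.castLE hm x) ∨ 4 ≤ y.val := by
  by_cases h : y.val < 4
  · exact Or.inl ⟨⟨y, h⟩, rfl⟩
  · exact Or.inr (by omega)

theorem voteSign_baseVote_castLE {m : ℕ} (hm : 4 ≤ m) (i : Fin 5) (x y : Fin 4) :
    voteSign (baseVote hm i) (Fin.castLE hm x) (Fin.castLE hm y) = voteSign (smallVote i) x y := by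
  have key : ∀ u v : Fin 4, Vote.Prefers (baseVote hm i) (Fin.castLE hm u) (Fin.castLE hm v)
      ↔ Vote.Prefers (smallVote i) u v := fun u v => by
    simp [Vote.Prefers, baseVote_castLE]
  simp only [voteSign, key]

theorem voteSign_baseVote_of_four_le {m : ℕ} (hm : 4 ≤ m) (i : Fin 5) (x : Fin 4) {y : Fin m}
    (hy : 4 ≤ y.val) : voteSign (baseVote hm i) (Fin.castLE hm x) y = 1 := by
  have h1 : baseVote hm i (Fin.castLE hm x) < baseVote hm i y := by
    rw [baseVote_castLE, baseVote_of_four_le hm i hy, Fin.lt_def]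
    simp only [Fin.val_castLE]
    omega
  have h2 : ¬ Vote.Prefers (baseVote hm i) y (Fin.castLE hm x) := h1.not_gt
  rw [voteSign, if_pos (show Vote.Prefers _ _ _ from h1), if_neg h2, sub_zero]

theorem baseVote_injective {m : ℕ} (hm : 4 ≤ m) : Function.Injective (baseVote hm) := by
  intro i j hij
  have h : ∀ x, smallVote i x = smallVote j x := fun x => by
    have := DFunLike.congr_fun hij (Fin.castLE hm x)
    rw [baseVote_castLE, baseVote_castLE] at this
    exact Fin.castLE_injective hm this
  clear hij
  revert i j
  decide

/-- The budget that reverses `c i` voters with the vote `baseVote hm i`, for every `i`. -/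
def baseBudget {m : ℕ} (hm : 4 ≤ m) (c : Fin 5 → ℕ) (R : Vote m) : ℕ :=
  ∑ i, if R = baseVote hm i then c i else 0

theorem baseBudget_baseVote {m : ℕ} (hm : 4 ≤ m) (c : Fin 5 → ℕ) (i : Fin 5) :
    baseBudget hm c (baseVote hm i) = c i := by
  simp [baseBudget, (baseVote_injective hm).eq_iff]

theorem baseBudget_le {m n : ℕ} (hm : 4 ≤ m) {c : Fin 5 → ℕ} {P : Profile m n}
    (h : ∀ i, c i ≤ voteCount P (baseVote hm i)) (R : Vote m) :
    baseBudget hm c R ≤ voteCount P R := by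
  by_cases hR : ∃ i, R = baseVote hm i
  · obtain ⟨i, rfl⟩ := hR
    rw [baseBudget_baseVote]
    exact h i
  · push Not at hR
    simp [baseBudget, hR]

theorem baseBudget_update {m : ℕ} (hm : 4 ≤ m) (c : Fin 5 → ℕ) (i : Fin 5) (t : ℕ) :
    baseBudget hm (Function.update c i t)
      = Function.update (baseBudget hm c) (baseVote hm i) t := by
  funext R
  by_cases hR : ∃ l, R = baseVote hm l
  · obtain ⟨l, rfl⟩ := hR
    rw [baseBudget_baseVote]
    by_cases hl : l = i
    · subst hl; simp
    · rw [Function.update_of_ne hl, Function.update_of_ne ((baseVote_injective hm).ne hl),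
        baseBudget_baseVote]
  · push Not at hR
    rw [Function.update_of_ne (hR i)]
    simp [baseBudget, hR]

theorem sum_baseBudget_mul {m : ℕ} (hm : 4 ≤ m) (c : Fin 5 → ℕ) (g : Vote m → ℤ) :
    ∑ R, (baseBudget hm c R : ℤ) * g R = ∑ i, (c i : ℤ) * g (baseVote hm i) := by
  simp only [baseBudget, Nat.cast_sum, Finset.sum_mul]
  rw [Finset.sum_comm]
  refine Finset.sum_congr rfl fun i _ => ?_
  rw [Finset.sum_eq_single (baseVote hm i)] <;> simp +contextual

/-! ### The contradiction behind the impossibility -/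

/-- The alternative `w`, where all alternatives beyond the first four are identified with `4`. -/
def coarse {m : ℕ} (w : Fin m) : Fin 5 := ⟨min w.val 4, by omega⟩

/-- The rank of an alternative in the `i`-th of the five votes, where `4` stands for all
alternatives beyond the first four. -/
def coarseRank (i : Fin 5) (x : Fin 5) : ℕ :=
  if h : x.val < 4 then (smallVote i ⟨x, h⟩).val else 4

theorem coarseRank_coarse {m : ℕ} (hm : 4 ≤ m) (i : Fin 5) (w : Fin m) :
    coarseRank i (coarse w) = min (baseVote hm i w).val 4 := by
  rcases eq_castLE_or_four_le hm w with ⟨x, rfl⟩ | hw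
  · have hx := x.isLt
    have h2 := (smallVote i x).isLt
    have : coarse (Fin.castLE hm x) = ⟨x, by omega⟩ := by
      simp [coarse]
    rw [this, baseVote_castLE]
    simp [coarseRank]
  · rw [baseVote_of_four_le hm i hw]
    simp [coarseRank, coarse, hw]

/-- The nine families of profiles along which the winner is followed. In family `p`, in units of
the common size, `pathStart p` says how many voters of each of the five kinds have reversed their
votes, except that the number for the kind `pathDir p` varies. -/
def pathStart : Fin 9 → Fin 5 → ℕ :=
  ![![0, 0, 0, 0, 0], ![0, 0, 0, 0, 0], ![1, 0, 0, 0, 0], ![1, 0, 0, 0, 0], ![0, 0, 0, 4, 0],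
    ![0, 0, 0, 0, 0], ![0, 0, 0, 4, 0], ![0, 1, 0, 4, 0], ![0, 1, 0, 0, 0]]

/-- The kind of voters who reverse their votes along the family `p`. -/
def pathDir : Fin 9 → Fin 5 := ![1, 0, 2, 3, 0, 3, 1, 4, 3]

/-- No choice of winners is consistent with half-way monotonicity along the nine families and the
Condorcet winners at four of their members. `N t` is the winner after `t i` units of the
`i`-th kind have reversed their votes. -/
theorem false_of_monotone (N : (Fin 5 → ℕ) → Fin 5)
    (mono : ∀ p s t, s ≤ t → t ≤ 4 →
      coarseRank (pathDir p) (N (Function.update (pathStart p) (pathDir p) s))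
        ≤ coarseRank (pathDir p) (N (Function.update (pathStart p) (pathDir p) t)))
    (ha : N ![0, 3, 0, 0, 0] = 0) (hb : N ![3, 0, 0, 4, 0] = 1)
    (hc : N ![0, 1, 0, 4, 4] = 2) (hd : N ![1, 0, 4, 0, 0] = 3) : False := by
  have step : ∀ p s t (f g : Fin 5 → ℕ), s ≤ t → t ≤ 4 →
      (∀ i, Function.update (pathStart p) (pathDir p) s i = f i) →
      (∀ i, Function.update (pathStart p) (pathDir p) t i = g i) →
      coarseRank (pathDir p) (N f) ≤ coarseRank (pathDir p) (N g) := by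
    intro p s t f g h1 h2 hf hg
    rw [← funext hf, ← funext hg]
    exact mono p s t h1 h2
  have e1 := step 0 0 3 ![0, 0, 0, 0, 0] ![0, 3, 0, 0, 0] (by decide) (by decide)
    (by decide) (by decide)
  have e2 := step 0 1 3 ![0, 1, 0, 0, 0] ![0, 3, 0, 0, 0] (by decide) (by decide)
    (by decide) (by decide)
  have e3 := step 1 0 1 ![0, 0, 0, 0, 0] ![1, 0, 0, 0, 0] (by decide) (by decide)
    (by decide) (by decide)
  have e4 := step 2 0 4 ![1, 0, 0, 0, 0] ![1, 0, 4, 0, 0] (by decide) (by decide)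
    (by decide) (by decide)
  have e5 := step 3 0 4 ![1, 0, 0, 0, 0] ![1, 0, 0, 4, 0] (by decide) (by decide)
    (by decide) (by decide)
  have e6 := step 4 1 3 ![1, 0, 0, 4, 0] ![3, 0, 0, 4, 0] (by decide) (by decide)
    (by decide) (by decide)
  have e7 := step 4 0 3 ![0, 0, 0, 4, 0] ![3, 0, 0, 4, 0] (by decide) (by decide)
    (by decide) (by decide)
  have e8 := step 5 0 4 ![0, 0, 0, 0, 0] ![0, 0, 0, 4, 0] (by decide) (by decide)
    (by decide) (by decide)
  have e9 := step 6 0 1 ![0, 0, 0, 4, 0] ![0, 1, 0, 4, 0] (by decide) (by decide)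
    (by decide) (by decide)
  have e10 := step 7 0 4 ![0, 1, 0, 4, 0] ![0, 1, 0, 4, 4] (by decide) (by decide)
    (by decide) (by decide)
  have e11 := step 8 0 4 ![0, 1, 0, 0, 0] ![0, 1, 0, 4, 0] (by decide) (by decide)
    (by decide) (by decide)
  rw [ha] at e1 e2
  rw [hb] at e6 e7
  rw [hc] at e10
  rw [hd] at e4
  generalize N ![0, 0, 0, 0, 0] = x0 at *
  generalize N ![1, 0, 0, 0, 0] = x1 at *
  generalize N ![1, 0, 0, 4, 0] = x2 at *
  generalize N ![0, 0, 0, 4, 0] = x3 at *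
  generalize N ![0, 1, 0, 4, 0] = x4 at *
  generalize N ![0, 1, 0, 0, 0] = x5 at *
  have h1 : x1 = 0 ∨ x1 = 3 := by
    clear ha hb hc hd e1 e2 e3 e7 e8 e9 e10 e11 step mono
    revert x1 x2
    decide
  -- the winner at the start is `a`
  have h0 : x0 = 0 := by
    clear ha hb hc hd e2 e4 e5 e6 e7 e8 e9 e10 e11 step mono
    revert x0 x1
    decide
  have h3 : x3 = 0 := by
    clear ha hb hc hd e1 e2 e3 e4 e5 e6 e9 e10 e11 step mono h1
    subst h0
    revert x3
    decide
  have h4 : x4 = 3 := by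
    clear ha hb hc hd e1 e2 e3 e4 e5 e6 e7 e8 e11 step mono h1 h0
    subst h3
    revert x4
    decide
  clear ha hb hc hd e1 e3 e4 e5 e6 e7 e8 e9 e10 step mono h1 h0 h3
  subst h4
  revert x5
  decide

/-! ### Violations for every rule -/

/-- The Condorcet criterion together with group half-way monotonicity at the profile `P`, for a
voting rule `w` restricted to profiles with `n` voters. -/
def Satisfies {m n : ℕ} (w : Profile m n → Fin m) (B : ℕ) (P : Profile m n) : Prop :=
  (∀ a, IsCondorcetWinner P a → w P = a) ∧
    ¬ ∃ S : Finset (Fin n), S.Nonempty ∧ S.card ≤ B ∧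
      ∀ j ∈ S, Vote.Prefers (P j) (w (flip P S)) (w P)

/-- The margin of `x` over `y` that `template` prescribes. -/
def templateMargin {m : ℕ} (hm : 4 ≤ m) (x y : Fin m) : ℤ :=
  ∑ i, (template i : ℤ) * voteSign (baseVote hm i) x y

/-- The `j`-th profile in the family `p`: coalitions of `B` voters of the kind `pathDir p` have
reversed their votes `j` times, and the size of the units of `pathStart` is `q * B`. -/
def pathProfile {m n : ℕ} (hm : 4 ≤ m) (B q : ℕ) (P : Profile m n) (p : Fin 9) (j : ℕ) :
    Profile m n :=
  flipFirst P
    (baseBudget hm fun i => B * Function.update (fun i => q * pathStart p i) (pathDir p) j i)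

theorem pathBudget_le {q : ℕ} {p : Fin 9} {j : ℕ} (hj : j ≤ 4 * q) (i : Fin 5) :
    Function.update (fun i => q * pathStart p i) (pathDir p) j i ≤ 4 * q := by
  by_cases h : i = pathDir p
  · subst h; simpa using hj
  · rw [Function.update_of_ne h, mul_comm]
    have : pathStart p i ≤ 4 := by clear h hj; revert p i; decide
    exact Nat.mul_le_mul_right q this

/-- Half-way monotonicity for coalitions of `B` voters forces the winner not to rise in the
original votes of the coalition. -/
theorem rank_le_of_satisfies {m n : ℕ} (hm : 4 ≤ m) {B q : ℕ} (hB : 0 < B)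
    (w : Profile m n → Fin m) (P : Profile m n)
    (hcnt : ∀ i, 4 * (q * B) ≤ voteCount P (baseVote hm i)) {p : Fin 9} {j : ℕ} (hj : j < 4 * q)
    (hs : Satisfies w B (pathProfile hm B q P p j)) :
    baseVote hm (pathDir p) (w (pathProfile hm B q P p j))
      ≤ baseVote hm (pathDir p) (w (pathProfile hm B q P p (j + 1))) := by
  set c : Fin 5 → ℕ :=
    fun i => B * Function.update (fun i => q * pathStart p i) (pathDir p) j i with hc
  have hcd : c (pathDir p) = B * j := by simp [hc]
  have hc' : (fun i => B * Function.update (fun i => q * pathStart p i) (pathDir p) (j + 1) i)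
      = Function.update c (pathDir p) (c (pathDir p) + B) := by
    funext i
    by_cases h : i = pathDir p
    · subst h; simp [hcd]; ring
    · simp [hc, h]
  obtain ⟨S, hS, hR, hflip⟩ := flipFirst_add_single P (baseBudget hm c)
    (baseVote hm (pathDir p)) B (by
      rw [baseBudget_baseVote, hcd]
      refine le_trans ?_ (hcnt _)
      nlinarith)
  have heq : pathProfile hm B q P p (j + 1) = flip (pathProfile hm B q P p j) S := by
    rw [pathProfile, hc', baseBudget_update, ← baseBudget_baseVote hm c (pathDir p), hflip]
    rfl
  by_contra hlt
  refine hs.2 ⟨S, Finset.card_pos.1 (hS ▸ hB), hS.le, fun l hl => ?_⟩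
  have hl' : pathProfile hm B q P p j l = baseVote hm (pathDir p) := hR l hl
  rw [hl', ← heq]
  exact not_le.1 hlt

theorem isCondorcetWinner_of_forall {m n : ℕ} (hm : 4 ≤ m) {u : ℕ} (P : Profile m n)
    (hcnt : ∀ i, 4 * u ≤ voteCount P (baseVote hm i))
    (hmar : ∀ (x : Fin 4) (y : Fin m), y ≠ Fin.castLE hm x →
      (u : ℤ) * (templateMargin hm (Fin.castLE hm x) y - 2)
        < majorityWeight P (Fin.castLE hm x) y)
    (t : Fin 5 → ℕ) (ht : ∀ i, t i ≤ 4) (x : Fin 4)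
    (hx : ∀ y, y ≠ x → 2 ≤ ∑ i, ((template i : ℤ) - 2 * t i) * voteSign (smallVote i) x y)
    (hx' : 2 ≤ ∑ i, ((template i : ℤ) - 2 * t i)) :
    IsCondorcetWinner (flipFirst P (baseBudget hm fun i => u * t i)) (Fin.castLE hm x) := by
  intro y hy
  have h2 : 2 ≤ ∑ i, ((template i : ℤ) - 2 * t i) * voteSign (baseVote hm i) (Fin.castLE hm x) y := by
    rcases eq_castLE_or_four_le hm y with ⟨y, rfl⟩ | hy4
    · simp only [voteSign_baseVote_castLE]
      exact hx y (fun h => hy (by rw [h]))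
    · simpa only [voteSign_baseVote_of_four_le hm _ x hy4, mul_one] using hx'
  rw [majorityWeight_flipFirst P _ (baseBudget_le hm fun i =>
    le_trans (by nlinarith [ht i]) (hcnt i)), sum_baseBudget_mul]
  have h3 := hmar x y hy
  have h4 : ∑ i, ((template i : ℤ) - 2 * t i) * voteSign (baseVote hm i) (Fin.castLE hm x) y
      = templateMargin hm (Fin.castLE hm x) y
        - 2 * ∑ i, (t i : ℤ) * voteSign (baseVote hm i) (Fin.castLE hm x) y := by
    rw [templateMargin, Finset.mul_sum, ← Finset.sum_sub_distrib]
    exact Finset.sum_congr rfl fun i _ => by ring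
  have h5 : ∑ i, ((u * t i : ℕ) : ℤ) * voteSign (baseVote hm i) (Fin.castLE hm x) y
      = u * ∑ i, (t i : ℤ) * voteSign (baseVote hm i) (Fin.castLE hm x) y := by
    rw [Finset.mul_sum]
    exact Finset.sum_congr rfl fun i _ => by push_cast; ring
  rw [h5]
  rw [h4] at h2
  nlinarith [mul_le_mul_of_nonneg_left h2 (Int.natCast_nonneg u)]

/-- If the margins of `P` are close to a multiple of those of `template`, then every voting rule
violates one of the two criteria at one of the `9 * (4 * q + 1)` profiles `pathProfile`. -/
theorem exists_not_satisfies {m n : ℕ} (hm : 4 ≤ m) {B q : ℕ} (hB : 0 < B)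
    (w : Profile m n → Fin m) (P : Profile m n)
    (hcnt : ∀ i, 4 * (q * B) ≤ voteCount P (baseVote hm i))
    (hmar : ∀ (x : Fin 4) (y : Fin m), y ≠ Fin.castLE hm x →
      ((q * B : ℕ) : ℤ) * (templateMargin hm (Fin.castLE hm x) y - 2)
        < majorityWeight P (Fin.castLE hm x) y) :
    ∃ (p : Fin 9) (j : Fin (4 * q + 1)), ¬ Satisfies w B (pathProfile hm B q P p j) := by
  by_contra! hall
  replace hall : ∀ p j, j ≤ 4 * q → Satisfies w B (pathProfile hm B q P p j) :=
    fun p j hj => hall p ⟨j, by omega⟩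
  have mono : ∀ p s t, s ≤ t → t ≤ 4 * q →
      baseVote hm (pathDir p) (w (pathProfile hm B q P p s))
        ≤ baseVote hm (pathDir p) (w (pathProfile hm B q P p t)) := by
    intro p s t hst
    induction t, hst using Nat.le_induction with
    | base => exact fun _ => le_rfl
    | succ t hst ih =>
      intro ht
      exact (ih (by omega)).trans
        (rank_le_of_satisfies hm hB w P hcnt (by omega) (hall p t (by omega)))
  -- the profiles at which the families meet
  let node : (Fin 5 → ℕ) → Profile m n := fun t =>
    flipFirst P (baseBudget hm fun i => (q * B) * t i)
  have hnode : ∀ p s, pathProfile hm B q P p (q * s)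
      = node (Function.update (pathStart p) (pathDir p) s) := by
    intro p s
    simp only [node, pathProfile]
    congr 2
    funext i
    by_cases h : i = pathDir p
    · subst h; simp; ring
    · simp [h]; ring
  have hsat : ∀ (t : Fin 5 → ℕ) (p : Fin 9) (s : ℕ), s ≤ 4 →
      (∀ i, Function.update (pathStart p) (pathDir p) s i = t i) →
      Satisfies w B (node t) := by
    intro t p s hs ht
    rw [← funext ht, ← hnode]
    exact hall p _ (by nlinarith)
  have hcw : ∀ (t : Fin 5 → ℕ) (x : Fin 4), Satisfies w B (node t) → (∀ i, t i ≤ 4) →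
      (∀ y, y ≠ x → 2 ≤ ∑ i, ((template i : ℤ) - 2 * t i) * voteSign (smallVote i) x y) →
      2 ≤ ∑ i, ((template i : ℤ) - 2 * t i) → coarse (w (node t)) = x.castSucc := by
    intro t x hs h1 h2 h3
    rw [hs.1 _ (isCondorcetWinner_of_forall hm P hcnt hmar t h1 x h2 h3)]
    apply Fin.ext
    simp [coarse]
  refine false_of_monotone (fun t => coarse (w (node t))) (fun p s t hst ht => ?_)
    (hcw _ 0 (hsat _ 0 3 (by decide) (by decide)) (by decide) (by decide) (by decide))
    (hcw _ 1 (hsat _ 4 3 (by decide) (by decide)) (by decide) (by decide) (by decide))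
    (hcw _ 2 (hsat _ 7 4 (by decide) (by decide)) (by decide) (by decide) (by decide))
    (hcw _ 3 (hsat _ 2 4 (by decide) (by decide)) (by decide) (by decide) (by decide))
  simp only [coarseRank_coarse hm]
  rw [← hnode, ← hnode]
  exact min_le_min_right 4
    (mono p (q * s) (q * t) (Nat.mul_le_mul_left q hst) (by nlinarith))

/-! ### Electorates of any size from 24 on -/

theorem majorityWeight_cons {m n : ℕ} (R : Vote m) (P : Profile m n) (x y : Fin m) :
    majorityWeight (Fin.cons R P : Profile m (n + 1)) x y
      = voteSign R x y + majorityWeight P x y := by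
  simp [majorityWeight_eq_sum, Fin.sum_univ_succ]

theorem voteCount_le_voteCount_cons {m n : ℕ} (R Q : Vote m) (P : Profile m n) :
    voteCount P Q ≤ voteCount (Fin.cons R P : Profile m (n + 1)) Q := by
  unfold voteCount
  rw [← Finset.card_map (Fin.succEmb n)]
  refine Finset.card_le_card fun j hj => ?_
  obtain ⟨i, hi, rfl⟩ := Finset.mem_map.1 hj
  simpa using hi

/-- Any even number of at least 24 voters is reached by adding pairs of votes that are opposite on
the first four alternatives and place the others at the bottom: such a pair lowers no margin of one
of the first four alternatives. -/
theorem exists_even_profile {m : ℕ} (hm : 4 ≤ m) (k : ℕ) :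
    ∃ P : Profile m (24 + 2 * k), (∀ i, 4 ≤ voteCount P (baseVote hm i)) ∧
      ∀ (x : Fin 4) (y : Fin m), y ≠ Fin.castLE hm x →
        templateMargin hm (Fin.castLE hm x) y ≤ majorityWeight P (Fin.castLE hm x) y := by
  induction k with
  | zero =>
    let f : Fin 24 → Fin 5 :=
      ![0, 0, 0, 0, 0, 0, 1, 1, 1, 1, 1, 1, 2, 2, 2, 2, 3, 3, 3, 3, 4, 4, 4, 4]
    have hf : ∀ i, (Finset.univ.filter fun j => f j = i).card = template i := by decide
    have ht : ∀ i, 4 ≤ template i := by decide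
    have hcard : ∀ i, voteCount (fun j => baseVote hm (f j)) (baseVote hm i) = template i := by
      intro i
      simp only [voteCount, (baseVote_injective hm).eq_iff]
      exact hf i
    refine ⟨fun j => baseVote hm (f j), fun i => (hcard i).symm ▸ ht i, fun x y _ => ?_⟩
    rw [majorityWeight_eq_sum, templateMargin, ← Finset.sum_fiberwise_of_maps_to
      (s := Finset.univ) (t := Finset.univ) (g := f) (fun _ _ => by simp)]
    refine Finset.sum_le_sum fun i _ => ?_
    rw [Finset.sum_congr rfl (g := fun _ => voteSign (baseVote hm i) (Fin.castLE hm x) y)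
      (fun j hj => by rw [(Finset.mem_filter.1 hj).2])]
    simp [← hf i]
  | succ k ih =>
    obtain ⟨P, h1, h2⟩ := ih
    -- the votes `adbc…` and `cbda…`
    let R : Vote m := Equiv.Perm.viaFintypeEmbedding (Vote.reverse (smallVote 0))
      (Fin.castLEEmb hm)
    refine ⟨Fin.cons (baseVote hm 0) (Fin.cons R P : Profile m (24 + 2 * k + 1)),
      fun i => (h1 i).trans ((voteCount_le_voteCount_cons R _ P).trans
        (voteCount_le_voteCount_cons (baseVote hm 0) _ _)), fun x y hy => ?_⟩
    have h3 : 0 ≤ voteSign (baseVote hm 0) (Fin.castLE hm x) y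
        + voteSign R (Fin.castLE hm x) y := by
      rcases eq_castLE_or_four_le hm y with ⟨y, rfl⟩ | hy4
      · have key : ∀ u v : Fin 4, Vote.Prefers R (Fin.castLE hm u) (Fin.castLE hm v)
            ↔ Vote.Prefers (Vote.reverse (smallVote 0)) u v := fun u v => by
          have h : ∀ u, R (Fin.castLE hm u) = Fin.castLE hm (Vote.reverse (smallVote 0) u) :=
            Equiv.Perm.viaFintypeEmbedding_apply_image _ (Fin.castLEEmb hm)
          simp [Vote.Prefers, h]
        have : voteSign R (Fin.castLE hm x) (Fin.castLE hm y)
            = voteSign (Vote.reverse (smallVote 0)) x y := by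
          simp only [voteSign, key]
        rw [voteSign_baseVote_castLE, this, voteSign_reverse]
        simp
      · rw [voteSign_baseVote_of_four_le hm 0 x hy4]
        have := (abs_le.1 (abs_voteSign_le_one R (Fin.castLE hm x) y)).1
        omega
    have h4 := h2 x y hy
    change _ ≤ majorityWeight (Fin.cons (baseVote hm 0)
      (Fin.cons R P : Profile m (24 + 2 * k + 1)) : Profile m (24 + 2 * k + 1 + 1)) _ y
    rw [majorityWeight_cons, majorityWeight_cons]
    omega

/-- With at least 24 voters, no rule satisfies both criteria at all profiles, even for coalitions
of a single voter. -/
theorem exists_not_satisfies_of_le {m n : ℕ} (hm : 4 ≤ m) (hn : 24 ≤ n)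
    (w : Profile m n → Fin m) : ∃ P, ¬ Satisfies w 1 P := by
  obtain ⟨P, h1, h2⟩ : ∃ P : Profile m n, (∀ i, 4 ≤ voteCount P (baseVote hm i)) ∧
      ∀ (x : Fin 4) (y : Fin m), y ≠ Fin.castLE hm x →
        templateMargin hm (Fin.castLE hm x) y - 1 ≤ majorityWeight P (Fin.castLE hm x) y := by
    obtain ⟨k, hk⟩ : ∃ k, n = 24 + 2 * k ∨ n = 24 + 2 * k + 1 := ⟨(n - 24) / 2, by omega⟩
    obtain ⟨P, h1, h2⟩ := exists_even_profile hm k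
    rcases hk with rfl | rfl
    · exact ⟨P, h1, fun x y hy => by have := h2 x y hy; omega⟩
    · refine ⟨Fin.cons (baseVote hm 0) P,
        fun i => (h1 i).trans (voteCount_le_voteCount_cons _ _ P), fun x y hy => ?_⟩
      rw [majorityWeight_cons]
      have := h2 x y hy
      have := (abs_le.1 (abs_voteSign_le_one (baseVote hm 0) (Fin.castLE hm x) y)).1
      omega
  obtain ⟨p, j, h⟩ := exists_not_satisfies hm (B := 1) (q := 1) one_pos w P
    (fun i => by simpa using h1 i)
    (fun x y hy => by have := h2 x y hy; push_cast; linarith)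
  exact ⟨_, h⟩

/-! ### Averaging over the names of the voters -/

theorem voteCount_comp {m n : ℕ} (P : Profile m n) (σ : Equiv.Perm (Fin n)) :
    voteCount (P ∘ σ : Profile m n) = voteCount P := by
  funext R
  refine Finset.card_bij (fun j _ => σ j) (fun j hj => by simpa using hj)
    (fun i _ j _ h => σ.injective h) fun j hj => ⟨σ.symm j, by simpa using hj, by simp⟩

theorem satisfies_comp {m n : ℕ} {w : Profile m n → Fin m} {B : ℕ} {P : Profile m n}
    (σ : Equiv.Perm (Fin n)) (h : Satisfies w B (P ∘ σ : Profile m n)) :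
    Satisfies (fun Q => w (Q ∘ σ : Profile m n)) B P := by
  refine ⟨fun a ha => h.1 a fun b hb => ?_, ?_⟩
  · rw [majorityWeight_eq_sum_voteCount, voteCount_comp, ← majorityWeight_eq_sum_voteCount]
    exact ha b hb
  · rintro ⟨S, hS, hSB, hpref⟩
    refine h.2 ⟨S.map σ.symm.toEmbedding, by simpa using hS, by simpa using hSB, fun j hj => ?_⟩
    have hflip : flip (P ∘ σ : Profile m n) (S.map σ.symm.toEmbedding)
        = (flip P S ∘ σ : Profile m n) := by
      funext i
      simp [flip, Finset.mem_map_equiv]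
    rw [hflip]
    exact hpref (σ j) (by simpa [Finset.mem_map_equiv] using hj)

/-- The number of permutations of the voters that fix the profile `P`. -/
def symmetryCount {m n : ℕ} (P : Profile m n) : ℕ := ∏ R, (voteCount P R).factorial

theorem exists_comp_eq {m n : ℕ} {P P' : Profile m n} (h : voteCount P = voteCount P') :
    ∃ τ : Equiv.Perm (Fin n), (P ∘ τ : Profile m n) = P' := by
  have e : ∀ R, Nonempty ({j // P' j = R} ≃ {j // P j = R}) := fun R => by
    have := congrFun h R
    simp only [voteCount] at this
    rw [← Fintype.card_eq, Fintype.card_subtype, Fintype.card_subtype, this]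
  refine ⟨Equiv.ofFiberEquiv (f := P') (g := P) fun R => (e R).some, ?_⟩
  funext j
  exact Equiv.ofFiberEquiv_map _ j

theorem card_comp_eq {m n : ℕ} (P P' : Profile m n) :
    (Finset.univ.filter fun σ : Equiv.Perm (Fin n) => (P ∘ σ : Profile m n) = P').card
      = if voteCount P = voteCount P' then symmetryCount P else 0 := by
  split_ifs with h
  · obtain ⟨τ, rfl⟩ := exists_comp_eq h
    have h1 := DomMulAct.stabilizer_card (f := P)
    rw [Fintype.card_subtype] at h1
    have h2 : symmetryCount P = ∏ R, (Fintype.card {j // P j = R}).factorial := by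
      simp [symmetryCount, voteCount, Fintype.card_subtype]
    rw [h2, ← h1]
    refine Finset.card_bij (fun σ _ => σ * τ⁻¹) (fun σ hσ => ?_) (fun σ _ ρ _ h => by simpa using h)
      fun ρ hρ => ⟨ρ * τ, ?_, by simp⟩
    · simp only [Finset.mem_filter, Finset.mem_univ, true_and] at hσ ⊢
      funext j
      simpa using congrFun hσ (τ⁻¹ j)
    · simp only [Finset.mem_filter, Finset.mem_univ, true_and] at hρ ⊢
      funext j
      simpa using congrFun hρ (τ j)
  · refine Finset.card_eq_zero.2 (Finset.filter_eq_empty_iff.2 fun σ _ hσ => h ?_)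
    rw [← hσ, voteCount_comp]

/-- Orbit-stabilizer for the action of the permutations of the voters on profiles. -/
theorem sum_symmetryCount {m n : ℕ} (P₁ : Profile m n) :
    ∑ P : Profile m n with voteCount P = voteCount P₁, symmetryCount P = n.factorial := by
  have h1 := Finset.card_eq_sum_card_fiberwise
    (f := fun σ : Equiv.Perm (Fin n) => (P₁ ∘ σ : Profile m n)) (s := Finset.univ)
    (t := Finset.univ) (fun _ _ => by simp)
  rw [Finset.card_univ, Fintype.card_perm, Fintype.card_fin] at h1
  rw [h1, Finset.sum_filter]
  refine Finset.sum_congr rfl fun P _ => ?_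
  rw [card_comp_eq]
  by_cases h : voteCount P = voteCount P₁
  · rw [if_pos h, if_pos h.symm, symmetryCount, symmetryCount, h]
  · rw [if_neg h, if_neg (Ne.symm h)]

/-- Let `Q` change the vote counts of the profiles in `W` by a fixed vector, and let `M` bound the
ratio of the numbers of symmetries of `Q P` and `P`. Summed over `P` in `W`, the number of renamings
of `Q P` that lie in `F` is at most `M * n! * F.card`, that is, `M` times the corresponding sum
for `P` itself over all profiles `P`. -/
theorem sum_card_comp_mem_le {m n : ℕ} (W F : Finset (Profile m n))
    (Q : Profile m n → Profile m n) (v : Vote m → ℤ)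
    (hQ : ∀ P ∈ W, ∀ R, (voteCount (Q P) R : ℤ) = voteCount P R + v R) {M : ℝ} (hM0 : 0 ≤ M)
    (hM : ∀ P ∈ W, (symmetryCount (Q P) : ℝ) ≤ M * symmetryCount P) :
    ∑ P ∈ W, ((Finset.univ.filter fun σ : Equiv.Perm (Fin n) =>
        (Q P ∘ σ : Profile m n) ∈ F).card : ℝ) ≤ M * n.factorial * F.card := by
  have h1 : ∀ P ∈ W, ((Finset.univ.filter fun σ : Equiv.Perm (Fin n) =>
      (Q P ∘ σ : Profile m n) ∈ F).card : ℝ)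
        ≤ ∑ P' ∈ F, if voteCount (Q P) = voteCount P' then M * symmetryCount P else 0 := by
    intro P hP
    rw [Finset.card_eq_sum_card_fiberwise
      (f := fun σ : Equiv.Perm (Fin n) => (Q P ∘ σ : Profile m n)) (t := F)
      (fun σ hσ => by simpa using hσ), Nat.cast_sum]
    refine Finset.sum_le_sum fun P' hP' => ?_
    have h2 : ((Finset.univ.filter fun σ : Equiv.Perm (Fin n) => (Q P ∘ σ : Profile m n) ∈ F).filter
        fun σ : Equiv.Perm (Fin n) => (Q P ∘ σ : Profile m n) = P').card
        ≤ if voteCount (Q P) = voteCount P' then symmetryCount (Q P) else 0 := by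
      rw [← card_comp_eq]
      exact Finset.card_le_card (Finset.filter_subset_filter _ (Finset.filter_subset _ _))
    split_ifs with h
    · rw [if_pos h] at h2
      exact le_trans (by exact_mod_cast h2) (hM P hP)
    · rw [if_neg h] at h2
      exact_mod_cast h2
  refine (Finset.sum_le_sum h1).trans ?_
  rw [Finset.sum_comm, mul_comm, ← nsmul_eq_mul]
  refine Finset.sum_le_card_nsmul _ _ _ fun P' _ => ?_
  rw [← Finset.sum_filter, ← Finset.mul_sum]
  refine mul_le_mul_of_nonneg_left ?_ hM0
  rcases (W.filter fun P => voteCount (Q P) = voteCount P').eq_empty_or_nonempty with h | ⟨P₁, hP₁⟩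
  · rw [h]; simp
  · rw [← sum_symmetryCount P₁, Nat.cast_sum]
    refine Finset.sum_le_sum_of_subset_of_nonneg (fun P hP => ?_) fun _ _ _ => Nat.cast_nonneg _
    rw [Finset.mem_filter] at hP hP₁
    refine Finset.mem_filter.2 ⟨Finset.mem_univ _, funext fun R => ?_⟩
    have e1 := hQ P hP.1 R
    have e2 := hQ P₁ hP₁.1 R
    rw [hP.2] at e1
    rw [hP₁.2] at e2
    omega

/-- If, for every profile in `W` and every renaming, one of the maps `Q i` leads into `F`, then `F`
is not much smaller than `W` divided by the number of maps. -/
theorem card_le_of_forall_exists_comp_mem {m n : ℕ} {I : Type*} [Fintype I]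
    (W F : Finset (Profile m n)) (Q : I → Profile m n → Profile m n) (v : I → Vote m → ℤ)
    (hQ : ∀ i, ∀ P ∈ W, ∀ R, (voteCount (Q i P) R : ℤ) = voteCount P R + v i R) {M : ℝ}
    (hM0 : 0 ≤ M) (hM : ∀ i, ∀ P ∈ W, (symmetryCount (Q i P) : ℝ) ≤ M * symmetryCount P)
    (hF : ∀ P ∈ W, ∀ σ : Equiv.Perm (Fin n), ∃ i, (Q i P ∘ σ : Profile m n) ∈ F) :
    (W.card : ℝ) ≤ Fintype.card I * M * F.card := by
  have h1 : ∀ P ∈ W, (n.factorial : ℝ) ≤ ∑ i, ((Finset.univ.filter fun σ : Equiv.Perm (Fin n) =>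
      (Q i P ∘ σ : Profile m n) ∈ F).card : ℝ) := by
    intro P hP
    have : (Finset.univ : Finset (Equiv.Perm (Fin n))) ⊆ Finset.univ.biUnion fun i =>
        Finset.univ.filter fun σ : Equiv.Perm (Fin n) => (Q i P ∘ σ : Profile m n) ∈ F := by
      intro σ _
      obtain ⟨i, hi⟩ := hF P hP σ
      exact Finset.mem_biUnion.2 ⟨i, Finset.mem_univ _, by simpa using hi⟩
    have h2 := (Finset.card_le_card this).trans Finset.card_biUnion_le
    rw [Finset.card_univ, Fintype.card_perm, Fintype.card_fin] at h2
    exact_mod_cast h2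
  have h3 := Finset.sum_le_sum h1
  rw [Finset.sum_const, Finset.sum_comm, nsmul_eq_mul] at h3
  have h4 := h3.trans (Finset.sum_le_sum fun i _ =>
    sum_card_comp_mem_le W F (Q i) (v i) (hQ i) hM0 (hM i))
  rw [Finset.sum_const, nsmul_eq_mul, Finset.card_univ] at h4
  have hn : (0 : ℝ) < n.factorial := by exact_mod_cast n.factorial_pos
  refine le_of_mul_le_mul_right (h4.trans_eq ?_) hn
  ring

theorem exp_neg_le_one_sub {x : ℝ} (h0 : 0 ≤ x) (h : x ≤ 1 / 2) : Real.exp (-(2 * x)) ≤ 1 - x := by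
  rw [Real.exp_neg]
  have h1 := Real.add_one_le_exp (2 * x)
  refine inv_le_of_inv_le₀ (by linarith) (le_trans ?_ h1)
  rw [inv_le_iff_one_le_mul₀ (by linarith)]
  nlinarith

/-- Factorials of numbers close to `A` grow like powers of `A`. -/
theorem factorial_le_zpow_mul {A δ K : ℝ} (hA : 0 < A) {h h' : ℕ} (hK : |(h' : ℝ) - h| ≤ K)
    (hδ : |(h : ℝ) - A| ≤ δ) (hAK : 2 * (δ + K) ≤ A) :
    (h'.factorial : ℝ)
      ≤ A ^ ((h' : ℤ) - h) * Real.exp (2 * K * ((δ + K) / A)) * h.factorial := by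
  have hK0 : 0 ≤ K := (abs_nonneg _).trans hK
  have hδ0 : 0 ≤ δ := (abs_nonneg _).trans hδ
  set x := (δ + K) / A with hx
  have hx0 : 0 ≤ x := by positivity
  have hx2 : x ≤ 1 / 2 := by rw [hx, div_le_iff₀ hA]; linarith
  have hxA : A * x = δ + K := by rw [hx]; field_simp
  rw [abs_le] at hK hδ
  rcases le_total h h' with hle | hle
  · obtain ⟨v, rfl⟩ := Nat.exists_eq_add_of_le hle
    push_cast at hK
    have h1 : ((h + v).factorial : ℝ) ≤ h.factorial * (h + v : ℝ) ^ v := by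
      rw [← Nat.factorial_mul_ascFactorial]
      push_cast
      gcongr
      exact_mod_cast Nat.ascFactorial_le_pow_add h v
    have h2 : (h + v : ℝ) ≤ A * Real.exp x := by
      have := Real.add_one_le_exp x
      nlinarith
    have h3 : (h + v : ℝ) ^ v ≤ A ^ v * Real.exp (2 * K * x) := by
      refine (pow_le_pow_left₀ (by positivity) h2 v).trans ?_
      rw [mul_pow, ← Real.exp_nat_mul]
      gcongr
      nlinarith
    have h4 : ((h + v : ℕ) : ℤ) - h = (v : ℤ) := by push_cast; ring
    rw [h4, zpow_natCast]
    refine h1.trans ?_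
    rw [mul_comm]
    gcongr
  · obtain ⟨v, rfl⟩ := Nat.exists_eq_add_of_le hle
    push_cast at hK hδ
    have h1 : (h'.factorial : ℝ) * (h' + 1 : ℝ) ^ v ≤ (h' + v).factorial := by
      exact_mod_cast Nat.factorial_mul_pow_le_factorial
    have h2 : A * Real.exp (-(2 * x)) ≤ h' + 1 := by
      have := exp_neg_le_one_sub hx0 hx2
      nlinarith
    have h3 : A ^ v * Real.exp (-(2 * K * x)) ≤ (h' + 1 : ℝ) ^ v := by
      refine le_trans ?_ (pow_le_pow_left₀ (by positivity) h2 v)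
      rw [mul_pow, ← Real.exp_nat_mul]
      gcongr
      nlinarith
    have h4 : (h' : ℤ) - (h' + v : ℕ) = -(v : ℤ) := by push_cast; ring
    rw [h4, zpow_neg, zpow_natCast]
    have h5 : (h'.factorial : ℝ) * (A ^ v * Real.exp (-(2 * K * x))) ≤ (h' + v).factorial :=
      (mul_le_mul_of_nonneg_left h3 (by positivity)).trans h1
    calc (h'.factorial : ℝ)
        = (A ^ v)⁻¹ * Real.exp (2 * K * x)
          * (h'.factorial * (A ^ v * Real.exp (-(2 * K * x)))) := by
          rw [Real.exp_neg]
          field_simp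
      _ ≤ _ := by gcongr

theorem symmetryCount_le {m n : ℕ} {A δ K : ℝ} (hA : 0 < A) {P Q : Profile m n}
    (hK : ∀ R, |(voteCount Q R : ℝ) - voteCount P R| ≤ K)
    (hδ : ∀ R, |(voteCount P R : ℝ) - A| ≤ δ) (hAK : 2 * (δ + K) ≤ A) :
    (symmetryCount Q : ℝ)
      ≤ Real.exp (2 * K * ((δ + K) / A)) ^ m.factorial * symmetryCount P := by
  have h1 : (symmetryCount Q : ℝ) ≤ ∏ R, (A ^ ((voteCount Q R : ℤ) - voteCount P R)
      * Real.exp (2 * K * ((δ + K) / A)) * (voteCount P R).factorial) := by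
    rw [symmetryCount, Nat.cast_prod]
    exact Finset.prod_le_prod (fun _ _ => by positivity)
      fun R _ => factorial_le_zpow_mul hA (hK R) (hδ R) hAK
  -- the powers of `A` cancel since both profiles have `n` voters
  have h2 : ∏ R : Vote m, A ^ ((voteCount Q R : ℤ) - voteCount P R) = 1 := by
    have h3 : ∑ R : Vote m, ((voteCount Q R : ℤ) - voteCount P R) = 0 := by
      rw [Finset.sum_sub_distrib]
      have e1 := sum_voteCount P
      have e2 := sum_voteCount Q
      zify at e1 e2
      rw [e1, e2, sub_self]
    have h4 : ∀ s : Finset (Vote m), ∏ R ∈ s, A ^ ((voteCount Q R : ℤ) - voteCount P R)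
        = A ^ ∑ R ∈ s, ((voteCount Q R : ℤ) - voteCount P R) := by
      intro s
      induction s using Finset.induction_on with
      | empty => simp
      | insert R s hR ih => rw [Finset.prod_insert hR, Finset.sum_insert hR, ih, zpow_add₀ hA.ne']
    rw [h4, h3, zpow_zero]
  rw [Finset.prod_mul_distrib, Finset.prod_mul_distrib, h2, one_mul, Finset.prod_const,
    Finset.card_univ, Fintype.card_perm, Fintype.card_fin] at h1
  refine h1.trans_eq ?_
  rw [symmetryCount, Nat.cast_prod]

/-! ### Typical vote counts -/

theorem sum_profile_succ {m n : ℕ} (f : Profile m (n + 1) → ℝ) :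
    ∑ P, f P = ∑ R : Vote m, ∑ P : Profile m n, f (Fin.cons R P : Profile m (n + 1)) := by
  rw [← Fintype.sum_prod_type']
  exact (Fintype.sum_equiv (Fin.consEquiv fun _ : Fin (n + 1) => Vote m) _ _ fun _ => rfl).symm

theorem sum_profile_sum_eq_zero {m : ℕ} (g : Vote m → ℝ) (hg : ∑ R, g R = 0) (n : ℕ) :
    ∑ P : Profile m n, ∑ j, g (P j) = 0 := by
  induction n with
  | zero => simp
  | succ n ih =>
    rw [sum_profile_succ]
    simp only [Fin.sum_univ_succ, Fin.cons_zero, Fin.cons_succ, Finset.sum_add_distrib, ih]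
    simp [← Finset.mul_sum, hg]

/-- The variance of a sum of independent, uniformly distributed, centred terms. -/
theorem sum_profile_sum_sq {m : ℕ} (g : Vote m → ℝ) (hg : ∑ R, g R = 0) (n : ℕ) :
    (m.factorial : ℝ) * ∑ P : Profile m n, (∑ j, g (P j)) ^ 2
      = n * (m.factorial : ℝ) ^ n * ∑ R, g R ^ 2 := by
  induction n with
  | zero => simp
  | succ n ih =>
    have h1 : ∀ R : Vote m, ∑ P : Profile m n, (g R + ∑ j, g (P j)) ^ 2
        = (m.factorial : ℝ) ^ n * g R ^ 2 + ∑ P : Profile m n, (∑ j, g (P j)) ^ 2 := by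
      intro R
      simp only [add_sq, Finset.sum_add_distrib]
      rw [← Finset.mul_sum, sum_profile_sum_eq_zero g hg]
      simp [Fintype.card_perm]
    rw [sum_profile_succ]
    simp only [Fin.sum_univ_succ, Fin.cons_zero, Fin.cons_succ, h1, Finset.sum_add_distrib]
    rw [← Finset.mul_sum, Finset.sum_const, Finset.card_univ, Fintype.card_perm, Fintype.card_fin,
      nsmul_eq_mul, ih]
    push_cast
    ring

/-- The profiles in which every vote is cast about equally often, with an error of at most
`2 * √n`. -/
noncomputable def typicalProfiles (m n : ℕ) : Finset (Profile m n) :=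
  Finset.univ.filter fun P => ∀ R, |(voteCount P R : ℝ) - n / m.factorial| ≤ 2 * √(n : ℝ)

theorem card_far_voteCount_le {m n : ℕ} (hn : 0 < n) (R : Vote m) :
    (m.factorial : ℝ) * ((Finset.univ.filter fun P : Profile m n =>
      ¬ |(voteCount P R : ℝ) - n / m.factorial| ≤ 2 * √(n : ℝ)).card : ℝ)
        ≤ (m.factorial : ℝ) ^ n / 4 := by
  have hV : (0 : ℝ) < m.factorial := by exact_mod_cast m.factorial_pos
  have hn' : (0 : ℝ) < n := by exact_mod_cast hn
  let g : Vote m → ℝ := fun Q => (if Q = R then 1 else 0) - 1 / m.factorial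
  have hg : ∑ Q, g Q = 0 := by
    simp [g, Finset.sum_sub_distrib, Fintype.card_perm, hV.ne']
  have hg2 : ∑ Q, g Q ^ 2 ≤ 1 := by
    have h1 : ∀ Q, g Q ^ 2 = (if Q = R then 1 - 2 / (m.factorial : ℝ) else 0)
        + (1 / (m.factorial : ℝ)) ^ 2 := fun Q => by
      simp only [g]
      split_ifs <;> ring
    simp only [h1, Finset.sum_add_distrib, Finset.sum_ite_eq', Finset.mem_univ, if_true,
      Finset.sum_const, Finset.card_univ, Fintype.card_perm, Fintype.card_fin, nsmul_eq_mul]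
    have h2 : (m.factorial : ℝ) * (1 / (m.factorial : ℝ)) ^ 2 = 1 / m.factorial := by field_simp
    have h3 : 2 / (m.factorial : ℝ) = 2 * (1 / m.factorial) := by ring
    have h4 : 0 < 1 / (m.factorial : ℝ) := by positivity
    rw [h2, h3]
    linarith
  have hsum : ∀ P : Profile m n, ∑ j, g (P j) = (voteCount P R : ℝ) - n / m.factorial := by
    intro P
    simp only [g, voteCount, Finset.sum_sub_distrib, Finset.sum_boole]
    simp [div_eq_mul_inv]
  have h5 := sum_profile_sum_sq g hg n
  set S := Finset.univ.filter fun P : Profile m n =>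
      ¬ |(voteCount P R : ℝ) - n / m.factorial| ≤ 2 * √(n : ℝ) with hS
  have h6 : (S.card : ℝ) * (4 * n) ≤ ∑ P : Profile m n, (∑ j, g (P j)) ^ 2 := by
    rw [← nsmul_eq_mul]
    refine le_trans (Finset.card_nsmul_le_sum S _ _ fun P hP => ?_)
      (Finset.sum_le_sum_of_subset_of_nonneg (Finset.subset_univ S) fun _ _ _ => sq_nonneg _)
    rw [hsum, ← sq_abs]
    have h7 : 2 * √(n : ℝ) < |(voteCount P R : ℝ) - n / m.factorial| :=
      not_le.1 (Finset.mem_filter.1 hP).2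
    have h8 := Real.sq_sqrt hn'.le
    have h9 := Real.sqrt_nonneg (n : ℝ)
    nlinarith
  have h10 : (m.factorial : ℝ) * (S.card * (4 * n)) ≤ n * (m.factorial : ℝ) ^ n := by
    refine (mul_le_mul_of_nonneg_left h6 hV.le).trans ?_
    rw [h5]
    exact mul_le_of_le_one_right (by positivity) hg2
  refine le_of_mul_le_mul_right ?_ (show (0 : ℝ) < 4 * n by positivity)
  nlinarith

/-- By Chebyshev's inequality, most profiles are typical. -/
theorem le_card_typicalProfiles {m n : ℕ} (hn : 0 < n) :
    3 / 4 * (m.factorial : ℝ) ^ n ≤ (typicalProfiles m n).card := by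
  have hV : (0 : ℝ) < m.factorial := by exact_mod_cast m.factorial_pos
  let far : Vote m → Finset (Profile m n) := fun R => Finset.univ.filter fun P =>
    ¬ |(voteCount P R : ℝ) - n / m.factorial| ≤ 2 * √(n : ℝ)
  have h1 : (Finset.univ : Finset (Profile m n)) ⊆ typicalProfiles m n ∪ Finset.univ.biUnion far := by
    intro P _
    by_cases h : ∀ R, |(voteCount P R : ℝ) - n / m.factorial| ≤ 2 * √(n : ℝ)
    · exact Finset.mem_union_left _ (by simpa [typicalProfiles] using h)
    · obtain ⟨R, hR⟩ := not_forall.1 h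
      exact Finset.mem_union_right _ (Finset.mem_biUnion.2 ⟨R, Finset.mem_univ _,
        Finset.mem_filter.2 ⟨Finset.mem_univ _, hR⟩⟩)
  have h2 := (Finset.card_le_card h1).trans (Finset.card_union_le _ _)
  have h3 : ((Finset.univ.biUnion far).card : ℝ) ≤ ∑ R, ((far R).card : ℝ) := by
    exact_mod_cast Finset.card_biUnion_le
  have h4 : (m.factorial : ℝ) * ∑ R, ((far R).card : ℝ)
      ≤ m.factorial * ((m.factorial : ℝ) ^ n / 4) := by
    rw [Finset.mul_sum]
    refine (Finset.sum_le_sum fun R _ => card_far_voteCount_le hn R).trans_eq ?_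
    rw [Finset.sum_const, Finset.card_univ, Fintype.card_perm, Fintype.card_fin, nsmul_eq_mul]
  have h5 := le_of_mul_le_mul_left h4 hV
  have h6 : (m.factorial : ℝ) ^ n
      ≤ (typicalProfiles m n).card + (Finset.univ.biUnion far).card := by
    have : (Finset.univ : Finset (Profile m n)).card = m.factorial ^ n := by
      rw [Finset.card_univ, Fintype.card_fun, Fintype.card_perm, Fintype.card_fin, Fintype.card_fin]
    rw [this] at h2
    exact_mod_cast h2
  linarith

/-- Reversal, as a permutation of the set of all votes. -/
def reversePerm (m : ℕ) : Equiv.Perm (Vote m) :=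
  Function.Involutive.toPerm Vote.reverse reverse_reverse

theorem sum_voteSign {m : ℕ} (x y : Fin m) : ∑ R : Vote m, voteSign R x y = 0 := by
  have h := Equiv.sum_comp (reversePerm m) fun R => voteSign R x y
  have h2 : ∀ R, voteSign (reversePerm m R) x y = -voteSign R x y := fun R =>
    voteSign_reverse R x y
  simp only [h2, Finset.sum_neg_distrib] at h
  omega

/-- In a typical profile all margins are of the order `√n`. -/
theorem abs_majorityWeight_le {m n : ℕ} {P : Profile m n} (hP : P ∈ typicalProfiles m n)
    (x y : Fin m) : |(majorityWeight P x y : ℝ)| ≤ m.factorial * (2 * √(n : ℝ)) := by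
  have h1 : (majorityWeight P x y : ℝ)
      = ∑ R, ((voteCount P R : ℝ) - n / m.factorial) * (voteSign R x y : ℝ) := by
    have h2 : ∑ R : Vote m, (voteSign R x y : ℝ) = 0 := by exact_mod_cast sum_voteSign x y
    simp only [sub_mul, Finset.sum_sub_distrib, ← Finset.mul_sum, h2]
    rw [majorityWeight_eq_sum_voteCount]
    push_cast
    ring
  rw [h1]
  refine (Finset.abs_sum_le_sum_abs _ _).trans ?_
  have h3 : ∀ R ∈ (Finset.univ : Finset (Vote m)),
      |((voteCount P R : ℝ) - n / m.factorial) * (voteSign R x y : ℝ)| ≤ 2 * √(n : ℝ) := by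
    intro R _
    rw [abs_mul]
    have h4 : |(voteSign R x y : ℝ)| ≤ 1 := by exact_mod_cast abs_voteSign_le_one R x y
    exact (mul_le_of_le_one_right (abs_nonneg _) h4).trans ((Finset.mem_filter.1 hP).2 R)
  refine (Finset.sum_le_card_nsmul _ _ _ h3).trans_eq ?_
  rw [Finset.card_univ, Fintype.card_perm, Fintype.card_fin, nsmul_eq_mul]

/-! ### Large electorates -/

/-- The budget that, for every `i`, turns `template i / 2` units of `u` voters with the reverse of
the `i`-th base vote into voters with the `i`-th base vote; this moves every margin by `u` times the
margin of the template. -/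
def shiftBudget {m : ℕ} (hm : 4 ≤ m) (u : ℕ) (R : Vote m) : ℕ :=
  baseBudget hm (fun i => u * (template i / 2)) (Vote.reverse R)

theorem baseBudget_le_of_forall {m : ℕ} (hm : 4 ≤ m) {c : Fin 5 → ℕ} {b : ℕ} (h : ∀ i, c i ≤ b)
    (R : Vote m) : baseBudget hm c R ≤ b := by
  by_cases hR : ∃ i, R = baseVote hm i
  · obtain ⟨i, rfl⟩ := hR
    rw [baseBudget_baseVote]
    exact h i
  · push Not at hR
    simp [baseBudget, hR]

theorem shiftBudget_le {m : ℕ} (hm : 4 ≤ m) (u : ℕ) (R : Vote m) :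
    shiftBudget hm u R ≤ 3 * u := by
  refine baseBudget_le_of_forall hm (fun i => ?_) _
  have : template i / 2 ≤ 3 := by revert i; decide
  nlinarith

theorem majorityWeight_shift {m n : ℕ} (hm : 4 ≤ m) (u : ℕ) {P : Profile m n}
    (hP : ∀ R, shiftBudget hm u R ≤ voteCount P R) (x y : Fin m) :
    majorityWeight (flipFirst P (shiftBudget hm u)) x y
      = majorityWeight P x y + u * templateMargin hm x y := by
  have h1 : ∑ R, (shiftBudget hm u R : ℤ) * voteSign R x y
      = -∑ i, ((u * (template i / 2) : ℕ) : ℤ) * voteSign (baseVote hm i) x y := by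
    rw [← sum_baseBudget_mul hm _ fun R => voteSign R x y, ← Equiv.sum_comp (reversePerm m),
      ← Finset.sum_neg_distrib]
    refine Finset.sum_congr rfl fun R _ => ?_
    change (baseBudget hm _ (Vote.reverse (Vote.reverse R)) : ℤ) * voteSign (Vote.reverse R) x y = _
    rw [reverse_reverse, voteSign_reverse]
    ring
  have h2 : (u : ℤ) * templateMargin hm x y
      = 2 * ∑ i, ((u * (template i / 2) : ℕ) : ℤ) * voteSign (baseVote hm i) x y := by
    rw [templateMargin, Finset.mul_sum, Finset.mul_sum]
    refine Finset.sum_congr rfl fun i _ => ?_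
    have : (template i : ℤ) = 2 * ((template i / 2 : ℕ) : ℤ) := by revert i; decide
    rw [this]
    push_cast
    ring
  rw [majorityWeight_flipFirst P _ hP, h1, h2]
  ring

/-- For large `n`, every rule violates one of the two criteria at a fraction of the profiles that is
of the order `B / √n`: the profiles `pathProfile`, obtained from typical profiles after a shift,
form a family of `O(√n / B)` maps, each of which distorts the uniform distribution by a bounded
factor only, and one of them leads to a violation. -/
theorem card_not_satisfies_of_large {m : ℕ} (hm : 4 ≤ m) :
    ∃ (c : ℝ) (n₀ : ℕ), 0 < c ∧ ∀ (n B : ℕ) (w : Profile m n → Fin m) (F : Finset (Profile m n)),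
      n₀ ≤ n → 1 ≤ B → (B : ℝ) ≤ √(n : ℝ) → (∀ P, ¬ Satisfies w B P → P ∈ F) →
        c * ((B : ℝ) / √(n : ℝ)) * (m.factorial : ℝ) ^ n ≤ F.card := by
  obtain ⟨V, hV⟩ : ∃ V : ℕ, V = m.factorial := ⟨_, rfl⟩
  have hVpos : 0 < V := hV ▸ m.factorial_pos
  have hV0 : (0 : ℝ) < V := by exact_mod_cast hVpos
  set M : ℝ := Real.exp (14 * (V + 2) * (7 * V + 16) * V) ^ V with hM
  have hMpos : 0 < M := by positivity
  refine ⟨1 / (60 * (V + 2) * M), (V * (14 * V + 32)) ^ 2, by positivity, ?_⟩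
  intro n B w F hn hB1 hBn hF
  rw [← hV]
  set s : ℝ := √(n : ℝ) with hs
  have hB0 : (0 : ℝ) < B := by exact_mod_cast hB1
  have hs0 : 0 < s := hB0.trans_le hBn
  have hsn : s ^ 2 = n := Real.sq_sqrt (Nat.cast_nonneg n)
  have hn0 : 0 < n := by
    rcases Nat.eq_zero_or_pos n with h | h
    · rw [h] at hsn; push_cast at hsn; nlinarith
    · exact h
  have hslarge : (V : ℝ) * (14 * V + 32) ≤ s := by
    refine Real.le_sqrt_of_sq_le ?_
    exact_mod_cast hn
  -- the typical number of voters with a given vote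
  set A : ℝ := (n : ℝ) / V with hA
  have hAs : (14 * V + 32) * s ≤ A := by
    rw [hA, le_div_iff₀ hV0, ← hsn]
    nlinarith
  have hA0 : 0 < A := by positivity
  -- the number of coalitions in a unit, chosen so that a unit exceeds all typical margins
  set q : ℕ := ⌈(V + 1) * s / B⌉₊ with hq
  have hq1 : (V + 1) * s ≤ q * B := by
    rw [← div_le_iff₀ hB0]
    exact Nat.le_ceil _
  have hq2 : (q : ℝ) * B ≤ (V + 2) * s := by
    have h1 : (q : ℝ) < (V + 1) * s / B + 1 := Nat.ceil_lt_add_one (by positivity)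
    have h2 : (q : ℝ) * B ≤ ((V + 1) * s / B + 1) * B := by nlinarith
    rw [add_mul, div_mul_cancel₀ _ hB0.ne'] at h2
    linarith
  obtain ⟨u, hu⟩ : ∃ u : ℕ, u = q * B := ⟨_, rfl⟩
  have hu' : (u : ℝ) = q * B := by rw [hu]; push_cast; ring
  have hq0 : 1 ≤ q := by
    rw [Nat.one_le_iff_ne_zero]
    intro h
    rw [h] at hq1
    push_cast at hq1
    nlinarith
  let kp : Fin 9 × Fin (4 * q + 1) → Vote m → ℕ := fun i => baseBudget hm fun l =>
    B * Function.update (fun l => q * pathStart i.1 l) (pathDir i.1) i.2 l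
  let T : Profile m n → Profile m n := fun P => flipFirst P (shiftBudget hm u)
  have hkpu : ∀ i R, kp i R ≤ 4 * u := fun i R => baseBudget_le_of_forall hm (fun l => by
    have := Nat.mul_le_mul_left B
      (pathBudget_le (q := q) (p := i.1) (j := i.2) (Nat.lt_succ_iff.1 i.2.isLt) l)
    rw [hu]
    linarith) R
  have hcount : ∀ P ∈ typicalProfiles m n, ∀ R, |(voteCount P R : ℝ) - A| ≤ 2 * s := fun P hP R => by
    have := (Finset.mem_filter.1 hP).2 R
    rwa [← hV] at this
  have hmany : ∀ P ∈ typicalProfiles m n, ∀ R, 7 * u ≤ voteCount P R := fun P hP R => by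
    have h1 := (abs_le.1 (hcount P hP R)).1
    have h2 : (7 * u : ℝ) ≤ voteCount P R := by nlinarith
    exact_mod_cast h2
  have hshift : ∀ P ∈ typicalProfiles m n, ∀ R, shiftBudget hm u R ≤ voteCount P R :=
    fun P hP R => by
      have := shiftBudget_le hm u R
      have := hmany P hP R
      omega
  have hTcount : ∀ P ∈ typicalProfiles m n, ∀ R, voteCount (T P) R + shiftBudget hm u R
      = voteCount P R + shiftBudget hm u (Vote.reverse R) := fun P hP R =>
    voteCount_flipFirst P _ (hshift P hP) R
  have hTmany : ∀ P ∈ typicalProfiles m n, ∀ R, 4 * u ≤ voteCount (T P) R := fun P hP R => by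
    have h1 := hTcount P hP R
    have h2 := hmany P hP R
    have h3 := shiftBudget_le hm u R
    omega
  have hkp : ∀ i, ∀ P ∈ typicalProfiles m n, ∀ R, kp i R ≤ voteCount (T P) R := fun i P hP R =>
    (hkpu i R).trans (hTmany P hP R)
  have hQcount : ∀ i, ∀ P ∈ typicalProfiles m n, ∀ R,
      (voteCount (flipFirst (T P) (kp i)) R : ℤ) = voteCount P R
        + (shiftBudget hm u (Vote.reverse R) - shiftBudget hm u R
          + kp i (Vote.reverse R) - kp i R) := by
    intro i P hP R
    have h1 := hTcount P hP R
    have h2 := voteCount_flipFirst (T P) (kp i) (hkp i P hP) R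
    omega
  have hmain := card_le_of_forall_exists_comp_mem (typicalProfiles m n) F
    (fun i P => flipFirst (T P) (kp i)) _ hQcount hMpos.le ?_ ?_
  · have hcardI : (Fintype.card (Fin 9 × Fin (4 * q + 1)) : ℝ) ≤ 45 * q := by
      simp only [Fintype.card_prod, Fintype.card_fin]
      have : (1 : ℝ) ≤ q := by exact_mod_cast hq0
      push_cast
      linarith
    have hW := le_card_typicalProfiles (m := m) hn0
    rw [← hV] at hW
    have h1 : 3 / 4 * (V : ℝ) ^ n ≤ 45 * q * M * F.card :=
      hW.trans (hmain.trans (by gcongr))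
    have h2 : 3 / 4 * (V : ℝ) ^ n * B ≤ 45 * ((V + 2) * s) * M * F.card := by
      calc 3 / 4 * (V : ℝ) ^ n * B ≤ 45 * q * M * F.card * B := by gcongr
        _ = 45 * (q * B) * M * F.card := by ring
        _ ≤ _ := by gcongr
    have h3 : 1 / (60 * (V + 2) * M) * ((B : ℝ) / s) * (V : ℝ) ^ n
        = (V : ℝ) ^ n * B / (60 * (V + 2) * M * s) := by
      field_simp
    rw [h3, div_le_iff₀ (by positivity)]
    linarith
  · intro i P hP
    have hK : ∀ R, |(voteCount (flipFirst (T P) (kp i)) R : ℝ) - voteCount P R|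
        ≤ 7 * (V + 2) * s := by
      intro R
      have h1 : |(voteCount (flipFirst (T P) (kp i)) R : ℤ) - voteCount P R| ≤ 7 * u := by
        rw [hQcount i P hP R, abs_le]
        have h2 := shiftBudget_le hm u R
        have h3 := shiftBudget_le hm u (Vote.reverse R)
        have h4 := hkpu i R
        have h5 := hkpu i (Vote.reverse R)
        constructor <;> omega
      have h2 : |(voteCount (flipFirst (T P) (kp i)) R : ℝ) - voteCount P R| ≤ 7 * u := by
        exact_mod_cast h1
      refine h2.trans ?_
      rw [hu']
      linarith
    have h1 := symmetryCount_le hA0 hK (hcount P hP) (by linarith)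
    have h2 : 2 * (7 * (V + 2) * s) * ((2 * s + 7 * (V + 2) * s) / A)
        = 14 * (V + 2) * (7 * V + 16) * V := by
      rw [hA, ← hsn]
      field_simp
      ring
    rwa [h2, ← hV] at h1
  · intro P hP σ
    obtain ⟨p, j, h⟩ := exists_not_satisfies hm (q := q) hB1
      (fun Q => w (Q ∘ σ : Profile m n)) (T P) (fun i => hu ▸ hTmany P hP _) (fun x y hy => by
        have h1 := (abs_le.1 (abs_majorityWeight_le hP (Fin.castLE hm x) y)).1
        have h2 : (-(2 * (u : ℤ)) : ℝ) < (majorityWeight P (Fin.castLE hm x) y : ℝ) := by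
          refine lt_of_lt_of_le ?_ h1
          rw [← hV, Int.cast_natCast, hu']
          nlinarith
        have h3 : -(2 * (u : ℤ)) < majorityWeight P (Fin.castLE hm x) y := by exact_mod_cast h2
        rw [← hu, majorityWeight_shift hm u (hshift P hP)]
        linarith)
    exact ⟨(p, j), hF _ fun hsat => h (satisfies_comp σ hsat)⟩

/-! ### Reduction to uniformly distributed votes -/

theorem profilePr_nonneg {m n : ℕ} {p : Fin n → Vote m → ℝ} (hp : ∀ j R, 0 ≤ p j R)
    (E : Profile m n → Prop) : 0 ≤ profilePr p E := by
  refine Finset.sum_nonneg fun P _ => ?_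
  split_ifs
  · exact Finset.prod_nonneg fun j _ => hp j (P j)
  · exact le_rfl

/-- The satisfaction is at most the probability under uniformly distributed votes: that probability
is a weighted average of probabilities under product distributions with factors in `D`. -/
theorem semiRandomSat_le_profilePr_uniform {m : ℕ} {D : Set (Vote m → ℝ)} (hD : Admissible D)
    (X : PerProfileAxiom m) (r : VotingRule m) (n B : ℕ) :
    semiRandomSat X D r n B
      ≤ profilePr (fun _ _ => 1 / (m.factorial : ℝ)) fun P : Profile m n => X r n P B := by
  classical
  obtain ⟨ι, _, ω, z, hω, hω1, hz, hsum⟩ := mem_convexHull_iff_exists_fintype.1 hD.uniform_mem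
  have hbdd : BddBelow (Set.range fun p : Fin n → D =>
      profilePr (fun j => (p j : Vote m → ℝ)) fun P => X r n P B) := by
    refine ⟨0, ?_⟩
    rintro _ ⟨p, rfl⟩
    exact profilePr_nonneg (fun j R => (hD.subset_simplex (p j).2).1 R) _
  have hexp : profilePr (fun _ _ => 1 / (m.factorial : ℝ)) (fun P : Profile m n => X r n P B)
      = ∑ φ : Fin n → ι, (∏ j, ω (φ j)) * profilePr (fun j => z (φ j)) fun P => X r n P B := by
    simp only [profilePr, Finset.mul_sum]
    rw [Finset.sum_comm]
    refine Finset.sum_congr rfl fun P _ => ?_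
    split_ifs with h
    · have h1 : ∀ R, 1 / (m.factorial : ℝ) = ∑ i, ω i * z i R := fun R => by
        have := congrFun hsum R
        simpa [Finset.sum_apply] using this.symm
      calc ∏ _j : Fin n, 1 / (m.factorial : ℝ) = ∏ j, ∑ i, ω i * z i (P j) :=
            Finset.prod_congr rfl fun j _ => h1 (P j)
        _ = ∑ φ : Fin n → ι, ∏ j, ω (φ j) * z (φ j) (P j) := by
            rw [Finset.prod_univ_sum, Fintype.piFinset_univ]
        _ = _ := Finset.sum_congr rfl fun φ _ => Finset.prod_mul_distrib
    · simp
  have htot : ∑ φ : Fin n → ι, ∏ j, ω (φ j) = 1 := by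
    rw [← Fintype.piFinset_univ, ← Finset.prod_univ_sum]
    simp [hω1]
  rw [hexp, ← one_mul (semiRandomSat X D r n B), ← htot, Finset.sum_mul]
  refine Finset.sum_le_sum fun φ _ => mul_le_mul_of_nonneg_left ?_
    (Finset.prod_nonneg fun j _ => hω _)
  exact ciInf_le hbdd fun j => ⟨z (φ j), hz (φ j)⟩

open Classical in
theorem profilePr_uniform {m n : ℕ} (E : Profile m n → Prop) :
    profilePr (fun _ _ => 1 / (m.factorial : ℝ)) E
      = 1 - ((Finset.univ.filter fun P => ¬ E P).card : ℝ) / (m.factorial : ℝ) ^ n := by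
  have hV : (0 : ℝ) < m.factorial := by exact_mod_cast m.factorial_pos
  have h1 : ((Finset.univ.filter fun P => E P).card : ℝ)
      + ((Finset.univ.filter fun P => ¬ E P).card : ℝ) = (m.factorial : ℝ) ^ n := by
    have := Finset.card_filter_add_card_filter_not (s := (Finset.univ : Finset (Profile m n)))
      (fun P => E P)
    rw [Finset.card_univ, Fintype.card_fun, Fintype.card_perm, Fintype.card_fin,
      Fintype.card_fin] at this
    exact_mod_cast this
  have h2 : profilePr (fun _ _ => 1 / (m.factorial : ℝ)) E
      = ((Finset.univ.filter fun P => E P).card : ℝ) / (m.factorial : ℝ) ^ n := by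
    simp [profilePr, ← Finset.sum_filter, div_eq_mul_inv]
  rw [h2, eq_sub_iff_add_eq, ← add_div, h1, div_self (by positivity)]

end SemiRandomVoting

theorem theorem2 (m : ℕ) (hm : 4 ≤ m) (D : Set (SemiRandomVoting.Vote m → ℝ))
    (hD : SemiRandomVoting.Admissible D) :
    ∃ C : ℝ, 0 < C ∧
      ∀ (r : SemiRandomVoting.VotingRule m) (n B : ℕ), 24 ≤ n → 1 ≤ B → (B : ℝ) ≤ √(n : ℝ) →
        SemiRandomVoting.semiRandomSat (SemiRandomVoting.CandH m) D r n B
          ≤ 1 - C * ((B : ℝ) / √(n : ℝ)) := by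
  classical
  obtain ⟨c, n₀, hc, hlarge⟩ := SemiRandomVoting.card_not_satisfies_of_large hm
  have hV : (1 : ℝ) ≤ m.factorial := by exact_mod_cast m.factorial_pos
  have hV0 : (0 : ℝ) < m.factorial := by linarith
  refine ⟨min c (1 / (m.factorial : ℝ) ^ n₀), by positivity, fun r n B hn hB hBn => ?_⟩
  refine (SemiRandomVoting.semiRandomSat_le_profilePr_uniform hD _ r n B).trans ?_
  rw [SemiRandomVoting.profilePr_uniform]
  set F := Finset.univ.filter fun P : SemiRandomVoting.Profile m n =>
    ¬ SemiRandomVoting.CandH m r n P B with hF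
  have hF' : ∀ P, ¬ SemiRandomVoting.Satisfies (r n) B P → P ∈ F := fun P hP =>
    Finset.mem_filter.2 ⟨Finset.mem_univ P, hP⟩
  have hB0 : (0 : ℝ) < B := by exact_mod_cast hB
  have hs0 : 0 < √(n : ℝ) := hB0.trans_le hBn
  refine sub_le_sub_left ?_ 1
  rw [le_div_iff₀ (by positivity)]
  rcases le_or_gt n₀ n with h | h
  · refine le_trans ?_ (hlarge n B (r n) F h hB hBn hF')
    gcongr
    exact min_le_left _ _
  · -- for the finitely many small `n`, a single violation is enough
    obtain ⟨P, hP⟩ := SemiRandomVoting.exists_not_satisfies_of_le hm hn (r n)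
    have hPF : P ∈ F := hF' P fun hs => hP ⟨hs.1, fun ⟨S, h1, h2, h3⟩ =>
      hs.2 ⟨S, h1, h2.trans hB, h3⟩⟩
    have h1 : (1 : ℝ) ≤ F.card := by exact_mod_cast Finset.card_pos.2 ⟨P, hPF⟩
    refine le_trans ?_ h1
    have h2 : (B : ℝ) / √(n : ℝ) ≤ 1 := (div_le_one hs0).2 hBn
    have h3 : (m.factorial : ℝ) ^ n ≤ (m.factorial : ℝ) ^ n₀ := pow_le_pow_right₀ hV h.le
    calc min c (1 / (m.factorial : ℝ) ^ n₀) * ((B : ℝ) / √(n : ℝ)) * (m.factorial : ℝ) ^ n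
        ≤ 1 / (m.factorial : ℝ) ^ n₀ * 1 * (m.factorial : ℝ) ^ n₀ := by
          gcongr
          exact min_le_right _ _
      _ = 1 := by field_simp
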